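/- Let $(R,\mathfrak m)$ be a local ring, i.e. a commutative ring, not necessarily Noetherian, with a unique maximal ideal, and let $\kappa$ be its residue field. Suppose that $R$ is a normal domain (a domain integrally closed in its fraction field). Let $R^h$ be the Henselization of $R$, that is, the filtered colimit of all \'etale $R$-algebras $S$ equipped with a prime ideal $\mathfrak q$ lying over $\mathfrak m$ such that $\kappa\to\kappa(\mathfrak q)$ is an isomorphism. For a separable closure $\kappa^{sep}$ of $\kappa$, let $R^{sh}$ be the corresponding strict Henselization of $R$, that is, the filtered colimit of all \'etale $R$-algebras $S$ equipped with a prime ideal $\mathfrak q$ lying over $\mathfrak m$ and a $\kappa$-embedding $\kappa(\mathfrak q)\hookrightarrow\kappa^{sep}$. (In both cases the transition maps are the $R$-algebra homomorphisms compatible with the chosen primes and embeddings.) For a domain $A$, let $A^+$ denote its absolute integral closure, i.e. the integral closure of $A$ in an algebraic closure of its fraction field. Then: \begin{enumerate} \item $R^h$ and $R^{sh}$ are normal domains. \item For every ideal $I$ of $R$, $$I(R^h)^+\cap R \;=\; IR^+\cap R \;=\; I(R^{sh})^+\cap R,$$ where, for an $R$-algebra $A$ that is a domain, $IA^+\cap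 R$ denotes the preimage in $R$ of the ideal generated by $I$ in $A^+$. \end{enumerate} -/

import Mathlib

open CategoryTheory

universe u

/-- An étale algebra `S` over `R` together with an `R`-algebra homomorphism `S → k`.
Étale algebras are of finite presentation, so up to isomorphism they are all of the form
`R[X₁, …, Xₙ] / I`; using these representatives makes the index category small.

If `R` is local and `k` is an algebraic extension of its residue field `κ`, then to give such a
homomorphism is to give a prime `q` of `S` above the maximal ideal of `R` (its kernel) and a
`κ`-embedding of the residue field `κ(q)` into `k`.  For `k = κ` this just says `κ(q) = κ`. -/
structure PointedEtale (R k : Type u) [CommRing R] [CommRing k] [Algebra R k] : Type u where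
  n : ℕ
  I : Ideal (MvPolynomial (Fin n) R)
  etale : Algebra.Etale R (MvPolynomial (Fin n) R ⧸ I)
  point : (MvPolynomial (Fin n) R ⧸ I) →ₐ[R] k

namespace PointedEtale

/-- The underlying étale algebra. -/
abbrev ring {R k : Type u} [CommRing R] [CommRing k] [Algebra R k] (X : PointedEtale R k) :
    Type u :=
  MvPolynomial (Fin X.n) R ⧸ X.I

/-- Morphisms are the `R`-algebra homomorphisms compatible with the maps to `k`. -/
noncomputable instance category (R k : Type u) [CommRing R] [CommRing k] [Algebra R k] :
    SmallCategory (PointedEtale R k) where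
  Hom X Y := {f : X.ring →ₐ[R] Y.ring // Y.point.comp f = X.point}
  id X := ⟨AlgHom.id R X.ring, AlgHom.comp_id _⟩
  comp f g := ⟨g.1.comp f.1, by rw [← AlgHom.comp_assoc, g.2, f.2]⟩

/-- The tautological diagram of `R`-algebras. -/
noncomputable def diagram (R k : Type u) [CommRing R] [CommRing k] [Algebra R k] :
    PointedEtale R k ⥤ CommAlgCat.{u} R where
  obj X := CommAlgCat.of R X.ring
  map f := CommAlgCat.ofHom f.1

end PointedEtale

/-- The Henselization of a local ring `R`: the filtered colimit of the étale `R`-algebras `S`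
with a prime `q` above the maximal ideal of `R` such that `κ(q) = κ`. Localizations of `S` at
elements outside `q` belong to the system, so this is also the colimit of the local rings `S_q`. -/
noncomputable abbrev Henselization (R : Type u) [CommRing R] [IsLocalRing R] : Type u :=
  (Limits.colimit (PointedEtale.diagram R (IsLocalRing.ResidueField R)) : CommAlgCat.{u} R)

/-- The strict Henselization of a local ring `R` with respect to a separable closure `ksep` of
its residue field: the filtered colimit of the étale `R`-algebras `S` with a prime `q` above the
maximal ideal of `R` and an embedding of `κ(q)` into `ksep` over the residue field of `R`. -/
noncomputable abbrev StrictHenselization (R : Type u) [CommRing R] [IsLocalRing R]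
    (ksep : Type u) [Field ksep] [Algebra (IsLocalRing.ResidueField R) ksep]
    [IsSepClosure (IsLocalRing.ResidueField R) ksep]
    [Algebra R ksep] [IsScalarTower R (IsLocalRing.ResidueField R) ksep] : Type u :=
  (Limits.colimit (PointedEtale.diagram R ksep) : CommAlgCat.{u} R)

/-- The absolute integral closure `A⁺` of a domain `A`: the integral closure of `A` in an
algebraic closure of its fraction field. -/
abbrev AbsoluteIntegralClosure (A : Type u) [CommRing A] [IsDomain A] : Type u :=
  integralClosure A (AlgebraicClosure (FractionRing A))

/-- For an `R`-algebra `A` that is a domain, and an ideal `I` of `R`, the ideal `I A⁺ ∩ R`. -/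
noncomputable def plusContraction {R : Type u} [CommRing R] (A : Type u) [CommRing A] [IsDomain A]
    [Algebra R A] (I : Ideal R) : Ideal R :=
  let f : R →+* AbsoluteIntegralClosure A :=
    (algebraMap A (AbsoluteIntegralClosure A)).comp (algebraMap R A)
  (I.map f).comap f

/-! Over a normal domain, a pointed étale algebra can be shrunk to a connected component through the
point, which is again a normal domain (`Algebra.Etale.exists_isDomain_localizationAway`). Such
members are cofinal and inject into the colimit `A`, so `A` is a union of normal domains. For the
contractions, `R⁺` maps to `A⁺`, which gives one inclusion. For the other, membership in `IR⁺` is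
tested at each maximal ideal `Q` of `R⁺`. The ring `C = (R⁺)_Q` is a normal local domain with
algebraically closed fraction field, so pointed étale `C`-algebras have sections
(`Algebra.Etale.exists_section`). These glue to an embedding of `A` into `C`, which extends to `A⁺ →
C` and carries `IA⁺` into `IC`. Only algebraicity of `k` over the residue field matters, so both
Henselizations are treated at once. -/

/-! ### Étale algebras over a normal domain -/

section EtaleOverNormal

open TensorProduct

variable (R S K : Type*) [CommRing R] [CommRing S] [Algebra R S] [Algebra.Etale R S] [Field K]
  [Algebra R K]

theorem Algebra.Etale.isArtinianRing_tensorProduct_field : IsArtinianRing (S ⊗[R] K) := by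
  have : Module.Finite K (K ⊗[R] S) := Algebra.FormallyUnramified.finite_of_free K (K ⊗[R] S)
  have : IsArtinianRing (K ⊗[R] S) := IsArtinianRing.of_finite K _
  exact (Algebra.TensorProduct.comm R K S).toRingEquiv.isArtinianRing

theorem Algebra.Etale.isReduced_tensorProduct_field : IsReduced (S ⊗[R] K) := by
  have : IsReduced (K ⊗[R] S) := Algebra.FormallyUnramified.isReduced_of_field K _
  exact isReduced_of_injective (Algebra.TensorProduct.comm R S K).toRingEquiv
    (Algebra.TensorProduct.comm R S K).injective

variable [IsFractionRing R K]

theorem Algebra.Etale.algebraMap_tensorProduct_injective :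
    Function.Injective (algebraMap S (S ⊗[R] K)) :=
  Algebra.TensorProduct.includeLeft_injective (S := R) (IsFractionRing.injective R K)

-- Integral closure commutes with smooth base change, and the integral closure of `R` in `K` is `R`.
variable {R S} in
theorem Algebra.Etale.exists_algebraMap_eq_of_isIntegral [IsIntegrallyClosed R]
    {z : S ⊗[R] K} (hz : IsIntegral S z) : ∃ s, algebraMap S (S ⊗[R] K) s = z := by
  obtain ⟨w, hw⟩ := (TensorProduct.toIntegralClosure_bijective_of_smooth
    (R := R) (S := S) (B := K)).surjective ⟨z, hz⟩
  obtain rfl : Algebra.TensorProduct.map (.id S S) (integralClosure R K).val w = z :=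
    congrArg Subtype.val hw
  clear hw hz
  induction w with
  | zero => exact ⟨0, by simp⟩
  | add x y hx hy =>
    obtain ⟨a, ha⟩ := hx
    obtain ⟨b, hb⟩ := hy
    exact ⟨a + b, by rw [map_add, map_add, ha, hb]⟩
  | tmul s x =>
    obtain ⟨r, hr⟩ := (isIntegrallyClosed_iff K).mp ‹_› x.2
    refine ⟨r • s, ?_⟩
    rw [Algebra.TensorProduct.algebraMap_apply, Algebra.TensorProduct.map_tmul]
    change (r • s) ⊗ₜ[R] (1 : K) = s ⊗ₜ[R] (x : K)
    rw [← hr, TensorProduct.smul_tmul, Algebra.algebraMap_eq_smul_one]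

variable [IsDomain R]

variable {R S} in
/-- A point of an étale algebra over a normal domain lies in a connected component that is a
domain. -/
theorem Algebra.Etale.exists_isDomain_localizationAway [IsIntegrallyClosed R]
    {k : Type*} [Field k] (p : S →+* k) :
    ∃ e : S, p e ≠ 0 ∧ IsDomain (Localization.Away e) := by
  classical
  let K := FractionRing R
  let T := S ⊗[R] K
  have : IsArtinianRing T := isArtinianRing_tensorProduct_field R S K
  have : IsReduced T := isReduced_tensorProduct_field R S K
  have hinj : Function.Injective (algebraMap S T) := algebraMap_tensorProduct_injective R S K
  let ε := IsArtinianRing.equivPi T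
  have : Fintype (MaximalSpectrum T) := Fintype.ofFinite _
  -- The primitive idempotents of the product of fields `T` are roots of `X² - X`, hence integral,
  -- hence already in `S`.
  have hlift (m : MaximalSpectrum T) : ∃ s, algebraMap S T s = ε.symm (Pi.single m 1) := by
    refine exists_algebraMap_eq_of_isIntegral K
      ⟨Polynomial.X ^ 2 - Polynomial.X, by monicity!, ?_⟩
    simp only [Polynomial.eval₂_sub, Polynomial.eval₂_X_pow, Polynomial.eval₂_X]
    rw [← map_pow, sq, ← Pi.single_mul, mul_one, sub_self]
  choose e he using hlift
  have hsum : ∑ m, e m = 1 := by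
    apply hinj
    rw [map_sum, map_one]
    simp_rw [he]
    rw [← map_sum]
    apply ε.injective
    rw [AlgEquiv.apply_symm_apply, map_one]
    exact Finset.univ_sum_single (1 : ∀ m : MaximalSpectrum T, T ⧸ m.asIdeal)
  obtain ⟨m, hm⟩ : ∃ m, p (e m) ≠ 0 := by
    by_contra! h
    have := congrArg p hsum
    rw [map_sum, Finset.sum_eq_zero fun m _ ↦ h m, map_one] at this
    exact zero_ne_one this
  refine ⟨e m, hm, ?_⟩
  have hε (s : S) : ε (algebraMap S T (e m * s)) = Pi.single m (ε (algebraMap S T s) m) := by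
    rw [map_mul, he, map_mul, AlgEquiv.apply_symm_apply]
    ext i
    rcases eq_or_ne i m with rfl | hi
    · simp
    · simp [Pi.single_eq_of_ne hi]
  -- Inverting `e m` keeps only the `m`-th factor, which is a field.
  have hzero (s : S) : algebraMap S (Localization.Away (e m)) s = 0 ↔
      ε (algebraMap S T s) m = 0 := by
    rw [IsLocalization.map_eq_zero_iff (Submonoid.powers (e m))]
    constructor
    · rintro ⟨⟨_, n, rfl⟩, h⟩
      have h1 : ε (algebraMap S T (e m)) m = 1 := by
        rw [he, AlgEquiv.apply_symm_apply, Pi.single_eq_same]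
      have h2 := congrArg (fun x ↦ ε (algebraMap S T x) m) h
      simpa [h1] using h2
    · intro h
      refine ⟨⟨e m, Submonoid.mem_powers _⟩, hinj (ε.injective ?_)⟩
      simp only
      rw [hε, h]
      simp
  have : Nontrivial (Localization.Away (e m)) :=
    (IsLocalization.Away.lift (e m) (hm.isUnit) : Localization.Away (e m) →+* k).domain_nontrivial
  have : NoZeroDivisors (Localization.Away (e m)) := by
    refine ⟨fun {a b} hab ↦ ?_⟩
    obtain ⟨a, s, rfl⟩ := IsLocalization.exists_mk'_eq (Submonoid.powers (e m)) a
    obtain ⟨b, t, rfl⟩ := IsLocalization.exists_mk'_eq (Submonoid.powers (e m)) b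
    rw [← IsLocalization.mk'_mul] at hab
    have key (x : S) (s : Submonoid.powers (e m)) :
        IsLocalization.mk' (Localization.Away (e m)) x s = 0 ↔ ε (algebraMap S T x) m = 0 := by
      rw [← hzero]
      constructor
      · intro h
        rw [← IsLocalization.mk'_spec (Localization.Away (e m)) x s, h, zero_mul]
      · intro h
        rw [IsLocalization.mk'_eq_mul_mk'_one, h, zero_mul]
    rw [key] at hab ⊢
    rw [key]
    simpa using hab
  exact NoZeroDivisors.to_isDomain _

variable {R S} in
theorem Algebra.Etale.algebraMap_injective [Nontrivial S] :
    Function.Injective (algebraMap R S) := by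
  have : Module.IsTorsionFree R S := inferInstance
  exact FaithfulSMul.algebraMap_injective R S

theorem Algebra.Etale.isFractionRing_tensorProduct [IsDomain S] :
    IsFractionRing S (S ⊗[R] K) := by
  have hle : Algebra.algebraMapSubmonoid S (nonZeroDivisors R) ≤ nonZeroDivisors S := by
    rintro _ ⟨r, hr, rfl⟩
    have := algebraMap_injective (R := R) (S := S)
    exact map_mem_nonZeroDivisors _ this hr
  have : IsDomain (S ⊗[R] K) := IsLocalization.isDomain_of_le_nonZeroDivisors _ hle
  have : IsArtinianRing (S ⊗[R] K) := isArtinianRing_tensorProduct_field R S K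
  let : Field (S ⊗[R] K) := (IsArtinianRing.isField_of_isDomain _).toField
  have hinj := algebraMap_tensorProduct_injective R S K
  have : FaithfulSMul S (S ⊗[R] K) := (faithfulSMul_iff_algebraMap_injective _ _).mpr hinj
  refine IsFractionRing.of_field S _ fun z ↦ ?_
  obtain ⟨⟨x, y⟩, h⟩ := IsLocalization.surj
    (Algebra.algebraMapSubmonoid S (nonZeroDivisors R)) z
  refine ⟨x, y, (eq_div_of_mul_eq ?_ h)⟩
  exact (map_ne_zero_iff _ hinj).mpr (nonZeroDivisors.ne_zero (hle y.2))

variable {R S} in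
theorem Algebra.Etale.isIntegrallyClosed [IsIntegrallyClosed R] [IsDomain S] :
    IsIntegrallyClosed S := by
  have := isFractionRing_tensorProduct R S (FractionRing R)
  exact (isIntegrallyClosed_iff (S ⊗[R] FractionRing R)).mpr
    (exists_algebraMap_eq_of_isIntegral _)

theorem Algebra.Etale.isAlgebraic_of_isDomain [IsDomain S] : Algebra.IsAlgebraic R S := by
  let K := FractionRing R
  have : Module.Finite K (K ⊗[R] S) := Algebra.FormallyUnramified.finite_of_free K (K ⊗[R] S)
  have : Algebra.IsAlgebraic R (K ⊗[R] S) := (IsFractionRing.comap_isAlgebraic_iff (K := K)).mpr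
    inferInstance
  exact .of_injective (Algebra.TensorProduct.includeRight : S →ₐ[R] K ⊗[R] S)
    (Algebra.TensorProduct.includeRight_injective (IsFractionRing.injective R K))

-- By algebraicity, a nonzero `s` divides a nonzero element of `R`, which would die along with `s`.
variable {R S} in
theorem Algebra.Etale.injective_of_isDomain [IsDomain S] {A : Type*} [CommRing A]
    [Algebra R A] (hA : Function.Injective (algebraMap R A)) (f : S →ₐ[R] A) :
    Function.Injective f := by
  have := isAlgebraic_of_isDomain R S
  rw [injective_iff_map_eq_zero]
  intro s hs
  by_contra h0
  obtain ⟨r, hr, t, ht⟩ := (Algebra.IsAlgebraic.isAlgebraic (R := R) s).exists_nonzero_dvd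
    (mem_nonZeroDivisors_of_ne_zero h0)
  apply hr
  apply hA
  rw [← f.commutes, ht, map_mul, hs, zero_mul, map_zero]

/-- Two homomorphisms from an unramified algebra to a domain that agree at a point are equal. -/
theorem Algebra.FormallyUnramified.algHom_eq_of_comp_eq {R S T : Type*} [CommRing R] [CommRing S]
    [CommRing T] [IsDomain T] [Algebra R S] [Algebra R T] [Algebra.FormallyUnramified R S]
    [Algebra.EssFiniteType R S] {k : Type*} [CommRing k] [Nontrivial k] (p : T →+* k)
    (f g : S →ₐ[R] T) (h : ∀ s, p (f s) = p (g s)) : f = g := by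
  -- `t` is killed by all `1 ⊗ s - s ⊗ 1` and multiplies out to `1`. Agreement at the point gives `p
  -- (F t) = 1`, so `F t` can be cancelled in the domain `T`.
  obtain ⟨t, ht, ht1⟩ := Algebra.FormallyUnramified.iff_exists_tensorProduct.mp
    (inferInstance : Algebra.FormallyUnramified R S)
  let F : S ⊗[R] S →ₐ[R] T := Algebra.TensorProduct.lift f g fun _ _ ↦ .all _ _
  have hF (x : S ⊗[R] S) : p (F x) = p (f (Algebra.TensorProduct.lmul' R x)) := by
    induction x with
    | zero => simp
    | add x y hx hy => simp [hx, hy]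
    | tmul x y => simp [F, h]
  have h0 : F t ≠ 0 := by
    intro h0
    have := hF t
    rw [ht1, h0, map_zero, map_one, map_one] at this
    exact zero_ne_one this
  ext s
  have := congrArg F (ht s)
  rw [map_mul, map_zero, mul_eq_zero, or_iff_left h0, map_sub, sub_eq_zero] at this
  simpa [F] using this.symm

end EtaleOverNormal

/-! ### Normal local domains with algebraically closed fraction field -/

section AlgClosedFractionField

variable {A : Type*} [CommRing A] [IsLocalRing A] [IsIntegrallyClosed A]
  (F : Type*) [Field F] [Algebra A F] [IsFractionRing A F] [IsAlgClosed F]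

include F

/-- A monic lift of the polynomial has a root in `F`; normality puts that root in `A`. -/
theorem IsLocalRing.ResidueField.isAlgClosed_of_isAlgClosed_fractionField :
    IsAlgClosed (IsLocalRing.ResidueField A) := by
  refine IsAlgClosed.of_exists_root _ fun p hp hirr ↦ ?_
  obtain ⟨q, rfl, hdeg, hq⟩ := Polynomial.lifts_and_degree_eq_and_monic
    (Polynomial.mem_lifts_of_surjective (IsLocalRing.residue_surjective (R := A)) p) hp
  have hd : q.degree ≠ 0 := hdeg ▸ (Polynomial.degree_pos_of_irreducible hirr).ne'
  obtain ⟨z, hz⟩ := IsAlgClosed.exists_eval₂_eq_zero_of_injective (algebraMap A F)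
    (IsFractionRing.injective A F) q hd
  obtain ⟨a, rfl⟩ := (isIntegrallyClosed_iff F).mp ‹_› ⟨q, hq, hz⟩
  refine ⟨IsLocalRing.residue A a, ?_⟩
  rw [Polynomial.eval₂_at_apply, map_eq_zero_iff _ (IsFractionRing.injective A F)] at hz
  rw [Polynomial.eval_map, Polynomial.eval₂_at_apply, hz, map_zero]

variable [IsDomain A]

/-- A pointed étale algebra over a normal local domain with algebraically closed fraction field
has a section through the given point. -/
theorem Algebra.Etale.exists_section {S : Type*} [CommRing S] [Algebra A S] [Algebra.Etale A S]
    {k : Type*} [Field k] (p : S →+* k)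
    (hp : ∀ a ∈ IsLocalRing.maximalIdeal A, p (algebraMap A S a) = 0) :
    ∃ g : S →ₐ[A] A, ∀ s, p (algebraMap A S (g s)) = p s := by
  obtain ⟨e, he, hdom⟩ := exists_isDomain_localizationAway (R := A) p
  let S' := Localization.Away e
  let p' : S' →+* k := IsLocalization.Away.lift e he.isUnit
  have hp' (s : S) : p' (algebraMap S S' s) = p s := IsLocalization.Away.lift_eq e he.isUnit s
  have hinjS : Function.Injective (algebraMap A S') := algebraMap_injective
  have hff : Module.FaithfullyFlat A S' := by
    refine ⟨fun m hm htop ↦ ?_⟩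
    rw [IsLocalRing.eq_maximalIdeal hm, Ideal.smul_top_eq_map,
      Submodule.restrictScalars_eq_top_iff] at htop
    have hle : (IsLocalRing.maximalIdeal A).map (algebraMap A S') ≤ RingHom.ker p' := by
      rw [Ideal.map_le_iff_le_comap]
      intro a ha
      rw [Ideal.mem_comap, RingHom.mem_ker, IsScalarTower.algebraMap_apply A S S', hp', hp a ha]
    rw [htop, top_le_iff] at hle
    exact RingHom.ker_ne_top p' hle
  have hsurj : Function.Surjective (algebraMap A S') := by
    intro s
    have : Algebra.IsAlgebraic A S' := isAlgebraic_of_isDomain A S'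
    -- The fraction field of `S'` is algebraic over `F`, hence equal to it, so `s` is a fraction `a
    -- / b` over `A`; faithful flatness (`bS' ∩ A = bA`) then makes `b` divide `a` in `A`.
    obtain ⟨a, b, hb, hab⟩ : ∃ a b : A, b ≠ 0 ∧ algebraMap A S' b * s = algebraMap A S' a := by
      let L := FractionRing S'
      have hinjL : Function.Injective (algebraMap A L) := by
        rw [IsScalarTower.algebraMap_eq A S' L]
        exact (IsFractionRing.injective S' L).comp hinjS
      let : Algebra F L := (IsFractionRing.lift hinjL).toAlgebra
      have : IsScalarTower A F L := .of_algebraMap_eq fun a ↦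
        (IsFractionRing.lift_algebraMap hinjL a).symm
      have : Algebra.IsAlgebraic S' L := IsFractionRing.comap_isAlgebraic_iff (K := L) |>.mpr
        inferInstance
      have : Algebra.IsAlgebraic A L := .trans A S' L
      have : Algebra.IsAlgebraic F L := (IsFractionRing.comap_isAlgebraic_iff (A := A)).mp this
      obtain ⟨z, hz⟩ := (IsAlgClosed.algebraMap_bijective_of_isIntegral (k := F)
        (K := L)).surjective (algebraMap S' L s)
      obtain ⟨a, b, hb, rfl⟩ := IsFractionRing.div_surjective (A := A) z
      refine ⟨a, b, nonZeroDivisors.ne_zero hb, IsFractionRing.injective S' L ?_⟩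
      have hbF : algebraMap A F b ≠ 0 :=
        IsFractionRing.to_map_ne_zero_of_mem_nonZeroDivisors hb
      rw [map_mul, ← hz, ← IsScalarTower.algebraMap_apply, ← IsScalarTower.algebraMap_apply,
        IsScalarTower.algebraMap_apply A F L, ← map_mul, mul_div_cancel₀ _ hbF,
        ← IsScalarTower.algebraMap_apply]
    have ha : a ∈ Ideal.span {b} := by
      rw [← Ideal.comap_map_eq_self_of_faithfullyFlat (B := S') (Ideal.span {b}),
        Ideal.mem_comap, Ideal.map_span, Set.image_singleton, Ideal.mem_span_singleton]
      exact ⟨s, hab.symm⟩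
    obtain ⟨c, rfl⟩ := Ideal.mem_span_singleton.mp ha
    refine ⟨c, ?_⟩
    rw [map_mul] at hab
    exact (mul_left_cancel₀ ((map_ne_zero_iff _ hinjS).mpr hb) hab).symm
  let ε : A ≃ₐ[A] S' := AlgEquiv.ofBijective (Algebra.ofId A S') ⟨hinjS, hsurj⟩
  refine ⟨ε.symm.toAlgHom.comp (IsScalarTower.toAlgHom A S S'), fun s ↦ ?_⟩
  rw [← hp', ← hp', ← IsScalarTower.algebraMap_apply]
  congr 1
  exact ε.apply_symm_apply _

end AlgClosedFractionField

/-! ### The filtered system of pointed étale algebras and its colimit -/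

open Limits in
instance CommAlgCat.preservesFilteredColimits_forget (R : Type u) [CommRing R] :
    PreservesFilteredColimits (forget (CommAlgCat.{u} R)) := by
  let e : (commAlgCatEquivUnder (.of R)).functor ⋙ Under.forget (CommRingCat.of R) ⋙
      forget CommRingCat.{u} ≅ forget (CommAlgCat.{u} R) := NatIso.ofComponents fun _ ↦ .refl _
  have : PreservesFilteredColimits ((commAlgCatEquivUnder (.of R)).functor ⋙
      Under.forget (CommRingCat.of R) ⋙ forget CommRingCat.{u}) := ⟨fun J _ _ ↦ inferInstance⟩
  exact ⟨fun J _ _ ↦ preservesColimitsOfShape_of_natIso e⟩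

namespace PointedEtale

attribute [instance] PointedEtale.etale

section

variable {R k : Type u} [CommRing R] [CommRing k] [Algebra R k]

theorem exists_algEquiv {S : Type*} [CommRing S] [Algebra R S] [Algebra.Etale R S]
    (p : S →ₐ[R] k) :
    ∃ (X : PointedEtale R k) (e : S ≃ₐ[R] X.ring), X.point.comp e.toAlgHom = p := by
  obtain ⟨n, f, hf, -⟩ := Algebra.FinitePresentation.out (R := R) (A := S)
  let e := (Ideal.quotientKerAlgEquivOfSurjective hf).symm
  refine ⟨⟨n, RingHom.ker f, Algebra.Etale.of_equiv e, p.comp e.symm.toAlgHom⟩, e, ?_⟩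
  ext s
  exact congrArg p (e.symm_apply_apply s)

end

variable {R k : Type u} [CommRing R] [Field k] [Algebra R k]

theorem hom_eq_of_isDomain {X Y : PointedEtale R k} [IsDomain Y.ring] (f g : X ⟶ Y) : f = g := by
  refine Subtype.ext (Algebra.FormallyUnramified.algHom_eq_of_comp_eq Y.point.toRingHom _ _
    fun s ↦ ?_)
  exact DFunLike.congr_fun (f.2.trans g.2.symm) s

section

variable [IsDomain R] [IsIntegrallyClosed R]

theorem exists_hom_isDomain (X : PointedEtale R k) :
    ∃ (Y : PointedEtale R k) (_ : X ⟶ Y), IsDomain Y.ring := by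
  obtain ⟨e, he, hdom⟩ := Algebra.Etale.exists_isDomain_localizationAway (R := R)
    X.point.toRingHom
  let p : Localization.Away e →ₐ[R] k := IsLocalization.liftAlgHom (M := Submonoid.powers e)
    (f := X.point) (by
      rintro ⟨_, n, rfl⟩
      rw [map_pow]
      exact (Ne.isUnit he).pow n)
  obtain ⟨Y, ε, hY⟩ := exists_algEquiv p
  refine ⟨Y, ⟨ε.toAlgHom.comp (IsScalarTower.toAlgHom R X.ring (Localization.Away e)), ?_⟩,
    ε.symm.toMulEquiv.isDomain _⟩
  rw [← AlgHom.comp_assoc, hY]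
  ext s
  exact IsLocalization.lift_eq _ s

instance isFiltered : IsFiltered (PointedEtale R k) where
  nonempty := by
    obtain ⟨X, -⟩ := exists_algEquiv (Algebra.ofId R k)
    exact ⟨X⟩
  cocone_objs X Y := by
    have : Algebra.Etale R (TensorProduct R X.ring Y.ring) := .comp R X.ring _
    obtain ⟨Z, e, hZ⟩ := exists_algEquiv (R := R) (S := TensorProduct R X.ring Y.ring)
      (Algebra.TensorProduct.lift X.point Y.point fun _ _ ↦ .all _ _)
    refine ⟨Z, ⟨e.toAlgHom.comp Algebra.TensorProduct.includeLeft, ?_⟩,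
      ⟨e.toAlgHom.comp Algebra.TensorProduct.includeRight, ?_⟩, trivial⟩
    · rw [← AlgHom.comp_assoc, hZ, Algebra.TensorProduct.lift_comp_includeLeft]
    · rw [← AlgHom.comp_assoc, hZ]
      exact Algebra.TensorProduct.lift_comp_includeRight _ _ fun _ _ ↦ .all _ _
  -- Over a domain, parallel morphisms coincide by rigidity, so no coequalizer is needed.
  cocone_maps X Y f g := by
    obtain ⟨Z, h, hZ⟩ := exists_hom_isDomain Y
    exact ⟨Z, h, hom_eq_of_isDomain _ _⟩

end

/-- The canonical map from a member of the system to the colimit. -/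
noncomputable abbrev toColimit (X : PointedEtale R k) :
    X.ring →ₐ[R] (Limits.colimit (diagram R k) : CommAlgCat.{u} R) :=
  (Limits.colimit.ι (diagram R k) X).hom

theorem toColimit_hom {X Y : PointedEtale R k} (f : X ⟶ Y) (x : X.ring) :
    Y.toColimit (f.1 x) = X.toColimit x :=
  congrArg (fun g ↦ g.hom x) (Limits.colimit.w (diagram R k) f)

variable [IsDomain R] [IsIntegrallyClosed R]

theorem exists_isDomain_forall_mem_range
    (c : Finset (Limits.colimit (diagram R k) : CommAlgCat.{u} R)) :
    ∃ X : PointedEtale R k, IsDomain X.ring ∧ ∀ a ∈ c, a ∈ X.toColimit.range := by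
  classical
  suffices ∃ X : PointedEtale R k, ∀ a ∈ c, a ∈ X.toColimit.range by
    obtain ⟨X, hX⟩ := this
    obtain ⟨Y, f, hY⟩ := exists_hom_isDomain X
    refine ⟨Y, hY, fun a ha ↦ ?_⟩
    obtain ⟨x, rfl⟩ := hX a ha
    exact ⟨f.1 x, toColimit_hom f x⟩
  induction c using Finset.induction_on with
  | empty =>
    obtain ⟨X⟩ := IsFiltered.nonempty (C := PointedEtale R k)
    exact ⟨X, by simp⟩
  | insert a c _ ih =>
    obtain ⟨X, hX⟩ := ih
    obtain ⟨Y, y, hy⟩ := Limits.Concrete.colimit_exists_rep (diagram R k) a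
    obtain ⟨Z, f, g, -⟩ := IsFilteredOrEmpty.cocone_objs X Y
    refine ⟨Z, fun b hb ↦ ?_⟩
    rcases Finset.mem_insert.mp hb with rfl | hb
    · exact ⟨g.1 y, (toColimit_hom g y).trans hy⟩
    · obtain ⟨x, rfl⟩ := hX b hb
      exact ⟨f.1 x, toColimit_hom f x⟩

theorem toColimit_injective (X : PointedEtale R k) [IsDomain X.ring] :
    Function.Injective X.toColimit := by
  intro x y hxy
  obtain ⟨Y, f, g, h⟩ := Limits.Concrete.colimit_exists_of_rep_eq (diagram R k) x y hxy
  obtain ⟨Z, t, hZ⟩ := exists_hom_isDomain Y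
  have hinj : Function.Injective (f ≫ t).1 := Algebra.Etale.injective_of_isDomain
    Algebra.Etale.algebraMap_injective _
  have hfg : (f ≫ t).1 x = (g ≫ t).1 y := congrArg t.1 h
  rw [hom_eq_of_isDomain (g ≫ t) (f ≫ t)] at hfg
  exact hinj hfg

end PointedEtale

/-- A ring is a normal domain if any finitely many of its elements lie in a subring that is a
normal domain. -/
theorem isDomain_and_isIntegrallyClosed_of_forall_finset {A : Type*} [CommRing A]
    (h : ∀ c : Finset A, ∃ (S : Type u) (_ : CommRing S) (f : S →+* A), IsDomain S ∧
      IsIntegrallyClosed S ∧ Function.Injective f ∧ ∀ a ∈ c, a ∈ f.range) :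
    ∃ _ : IsDomain A, IsIntegrallyClosed A := by
  classical
  have : Nontrivial A := by
    obtain ⟨S, _, f, _, -, hf, -⟩ := h ∅
    exact hf.nontrivial
  have : NoZeroDivisors A := by
    refine ⟨fun {a b} hab ↦ ?_⟩
    obtain ⟨S, _, f, _, -, hf, hc⟩ := h {a, b}
    obtain ⟨a, rfl⟩ := hc a (by simp)
    obtain ⟨b, rfl⟩ := hc b (by simp)
    rw [← map_mul, map_eq_zero_iff f hf] at hab
    rw [map_eq_zero_iff f hf, map_eq_zero_iff f hf]
    exact mul_eq_zero.mp hab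
  have : IsDomain A := NoZeroDivisors.to_isDomain A
  refine ⟨this, (isIntegrallyClosed_iff (FractionRing A)).mpr fun {z} ⟨p, hp, hz⟩ ↦ ?_⟩
  obtain ⟨a, b, hb, rfl⟩ := IsFractionRing.div_surjective (A := A) z
  -- One subring contains the fraction and its whole integral equation.
  obtain ⟨S, _, f, _, _, hf, hc⟩ := h (insert a (insert b p.coeffs))
  obtain ⟨a, rfl⟩ := hc a (by simp)
  obtain ⟨b, rfl⟩ := hc b (by simp)
  have hb0 : b ≠ 0 := by
    rintro rfl
    exact nonZeroDivisors.ne_zero hb (map_zero f)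
  have hlift : p ∈ Polynomial.lifts f := by
    rw [Polynomial.lifts_iff_coeff_lifts]
    intro n
    by_cases hn : p.coeff n = 0
    · exact ⟨0, by rw [hn, map_zero]⟩
    · exact hc _ (by simp [Polynomial.coeff_mem_coeffs hn])
  obtain ⟨q, rfl, -, hq⟩ := Polynomial.lifts_and_degree_eq_and_monic hlift hp
  let ψ : FractionRing S →+* FractionRing A := IsFractionRing.map (K := FractionRing S) hf
  have hψ (s : S) : ψ (algebraMap S _ s) = algebraMap A _ (f s) :=
    IsLocalization.map_eq _ s
  have hint : IsIntegral S (algebraMap S (FractionRing S) a / algebraMap S _ b) := by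
    refine ⟨q, hq, ψ.injective ?_⟩
    rw [Polynomial.hom_eval₂, map_zero, map_div₀, hψ, hψ, ← hz, Polynomial.eval₂_map]
    congr 1
    ext s
    exact hψ s
  obtain ⟨c, hc⟩ := (isIntegrallyClosed_iff (FractionRing S)).mp ‹_› hint
  exact ⟨f c, by rw [← hψ, hc, map_div₀, hψ, hψ]⟩

namespace PointedEtale

variable (R k : Type u) [CommRing R] [Field k] [Algebra R k] [IsDomain R] [IsIntegrallyClosed R]

theorem isDomain_and_isIntegrallyClosed_colimit :
    ∃ _ : IsDomain (Limits.colimit (diagram R k) : CommAlgCat.{u} R),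
      IsIntegrallyClosed (Limits.colimit (diagram R k) : CommAlgCat.{u} R) := by
  refine isDomain_and_isIntegrallyClosed_of_forall_finset.{u} fun c ↦ ?_
  obtain ⟨X, hX, hc⟩ := exists_isDomain_forall_mem_range c
  exact ⟨X.ring, _, X.toColimit.toRingHom, hX, Algebra.Etale.isIntegrallyClosed (R := R),
    X.toColimit_injective, hc⟩

instance : IsDomain (Limits.colimit (diagram R k) : CommAlgCat.{u} R) :=
  (isDomain_and_isIntegrallyClosed_colimit R k).1

theorem algebraMap_colimit_injective :
    Function.Injective (algebraMap R (Limits.colimit (diagram R k) : CommAlgCat.{u} R)) := by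
  obtain ⟨X, hX, -⟩ := exists_isDomain_forall_mem_range (R := R) (k := k) ∅
  rw [← X.toColimit.comp_algebraMap]
  exact X.toColimit_injective.comp Algebra.Etale.algebraMap_injective

end PointedEtale

/-! ### Comparison of the contracted ideals -/

/-- Elements of `I B⁺ ∩ R` lie in `I C`, if `B` embeds into a ring `C` that is integrally closed
in an algebraically closed field. -/
theorem map_mem_map_of_mem_plusContraction {R B : Type u} [CommRing R] [CommRing B] [IsDomain B]
    [Algebra R B] {C F : Type*} [CommRing C] [Field F] [IsAlgClosed F] [Algebra C F]
    [IsIntegrallyClosedIn C F] (φ : B →+* C) (hφ : Function.Injective φ) {I : Ideal R} {r : R}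
    (hr : r ∈ plusContraction B I) :
    φ (algebraMap R B r) ∈ I.map (φ.comp (algebraMap R B)) := by
  have hCF : Function.Injective (algebraMap C F) := IsIntegralClosure.algebraMap_injective C C F
  let : Algebra B F := ((algebraMap C F).comp φ).toAlgebra
  have hBF : Function.Injective (algebraMap B F) := hCF.comp hφ
  let : Algebra (FractionRing B) F := (IsFractionRing.lift hBF).toAlgebra
  have : IsScalarTower B (FractionRing B) F := .of_algebraMap_eq fun b ↦
    (IsFractionRing.lift_algebraMap hBF b).symm
  let σ : AlgebraicClosure (FractionRing B) →ₐ[B] F :=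
    (IsAlgClosed.lift : AlgebraicClosure (FractionRing B) →ₐ[FractionRing B] F).restrictScalars B
  let ρ : C ≃+* (algebraMap C F).range :=
    RingEquiv.ofBijective (algebraMap C F).rangeRestrict
      ⟨fun _ _ h ↦ hCF (congrArg Subtype.val h), (algebraMap C F).rangeRestrict_surjective⟩
  -- `σ` sends elements integral over `B` to elements of `F` integral over `C`, which lie in `C`.
  let τ : AbsoluteIntegralClosure B →+* (algebraMap C F).range :=
    (σ.toRingHom.comp (algebraMap (AbsoluteIntegralClosure B)
      (AlgebraicClosure (FractionRing B)))).codRestrict _ fun x ↦ by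
        obtain ⟨p, hp, hx⟩ : IsIntegral B (σ x) := x.2.map σ
        refine IsIntegrallyClosedIn.isIntegral_iff.mp ⟨p.map φ, hp.map φ, ?_⟩
        rw [Polynomial.eval₂_map]
        exact hx
  let ψ : AbsoluteIntegralClosure B →+* C := ρ.symm.toRingHom.comp τ
  have hψ (b : B) : ψ (algebraMap B _ b) = φ b := by
    refine (ρ.symm_apply_eq).mpr (Subtype.ext ?_)
    exact σ.commutes b
  have hcomp : ψ.comp ((algebraMap B (AbsoluteIntegralClosure B)).comp (algebraMap R B)) =
      φ.comp (algebraMap R B) := RingHom.ext fun r ↦ hψ _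
  have := Ideal.mem_map_of_mem ψ (Ideal.mem_comap.mp hr)
  rw [Ideal.map_map, hcomp] at this
  rw [← hψ]
  exact this

theorem algebraMap_absoluteIntegralClosure_injective (A : Type u) [CommRing A] [IsDomain A] :
    Function.Injective (algebraMap A (AbsoluteIntegralClosure A)) := by
  have h : Function.Injective (algebraMap A (AlgebraicClosure (FractionRing A))) := by
    rw [IsScalarTower.algebraMap_eq A (FractionRing A)]
    exact (algebraMap (FractionRing A) (AlgebraicClosure (FractionRing A))).injective.comp
      (IsFractionRing.injective A _)
  exact fun a b hab ↦ h (congrArg Subtype.val hab)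

theorem isFractionRing_absoluteIntegralClosure (A : Type u) [CommRing A] [IsDomain A] :
    IsFractionRing (AbsoluteIntegralClosure A) (AlgebraicClosure (FractionRing A)) := by
  have : Algebra.IsAlgebraic A (AlgebraicClosure (FractionRing A)) :=
    (IsFractionRing.comap_isAlgebraic_iff (K := FractionRing A)).mpr inferInstance
  exact integralClosure.isFractionRing_of_algebraic fun a ha ↦
    (map_eq_zero_iff _ (algebraMap_absoluteIntegralClosure_injective A)).mp (Subtype.ext ha)

theorem Localization.AtPrime.exists_algebra_isFractionRing {B F : Type*} [CommRing B] [IsDomain B]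
    [Field F] [Algebra B F] [IsFractionRing B F] (Q : Ideal B) [Q.IsPrime] :
    ∃ _ : Algebra (Localization.AtPrime Q) F, IsFractionRing (Localization.AtPrime Q) F := by
  have hunit (y : Q.primeCompl) : IsUnit (algebraMap B F y) :=
    (IsFractionRing.to_map_ne_zero_of_mem_nonZeroDivisors
      (Q.primeCompl_le_nonZeroDivisors y.2)).isUnit
  let : Algebra (Localization.AtPrime Q) F := (IsLocalization.lift hunit).toAlgebra
  have : IsScalarTower B (Localization.AtPrime Q) F :=
    .of_algebraMap_eq fun b ↦ (IsLocalization.lift_eq hunit b).symm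
  exact ⟨inferInstance,
    IsFractionRing.isFractionRing_of_isDomain_of_isLocalization Q.primeCompl _ F⟩

namespace PointedEtale

section

variable {R k : Type u} [CommRing R] [Field k] [Algebra R k]
  {A : Type u} [CommRing A] [IsDomain A] [IsLocalRing A] [IsIntegrallyClosed A] [Algebra R A]
  (F : Type*) [Field F] [Algebra A F] [IsFractionRing A F] [IsAlgClosed F]

include F

theorem exists_algHom (ι : k →ₐ[R] IsLocalRing.ResidueField A) (X : PointedEtale R k) :
    ∃ f : X.ring →ₐ[R] A, ∀ x, IsLocalRing.residue A (f x) = ι (X.point x) := by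
  let p : TensorProduct R A X.ring →ₐ[A] IsLocalRing.ResidueField A :=
    Algebra.TensorProduct.lift (Algebra.ofId A _) (ι.comp X.point) fun _ _ ↦ .all _ _
  obtain ⟨g, hg⟩ := Algebra.Etale.exists_section (A := A) (S := TensorProduct R A X.ring) F
      p.toRingHom fun a ha ↦ by
    change p (algebraMap A _ a) = 0
    rw [p.commutes]
    exact (IsLocalRing.residue_eq_zero_iff a).mpr ha
  refine ⟨(g.restrictScalars R).comp Algebra.TensorProduct.includeRight, fun x ↦ ?_⟩
  have h1 : p (algebraMap A _ (g (1 ⊗ₜ x))) = p (1 ⊗ₜ x) := hg _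
  rw [p.commutes] at h1
  exact h1.trans (by simp [p])

theorem nonempty_colimit_algHom [IsLocalRing R] [Algebra (IsLocalRing.ResidueField R) k]
    [IsScalarTower R (IsLocalRing.ResidueField R) k]
    [Algebra.IsAlgebraic (IsLocalRing.ResidueField R) k] [IsLocalHom (algebraMap R A)] :
    Nonempty ((Limits.colimit (diagram R k) : CommAlgCat.{u} R) →ₐ[R] A) := by
  have : IsAlgClosed (IsLocalRing.ResidueField A) :=
    IsLocalRing.ResidueField.isAlgClosed_of_isAlgClosed_fractionField F
  let ι : k →ₐ[R] IsLocalRing.ResidueField A :=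
    (IsAlgClosed.lift : k →ₐ[IsLocalRing.ResidueField R] _).restrictScalars R
  choose f hf using exists_algHom F ι
  let c : Limits.Cocone (diagram R k) :=
    { pt := CommAlgCat.of R A
      ι :=
        { app X := CommAlgCat.ofHom (f X)
          naturality X Y g := by
            refine CommAlgCat.hom_ext ?_
            -- The chosen lifts are compatible because a map to `A` is determined by its residue.
            refine Algebra.FormallyUnramified.algHom_eq_of_comp_eq (R := R) (S := X.ring) (T := A)
              (IsLocalRing.residue A) ((f Y).comp g.1) (f X) fun x ↦ ?_
            rw [hf, AlgHom.comp_apply, hf]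
            exact congrArg ι (DFunLike.congr_fun g.2 x) } }
  exact ⟨(Limits.colimit.desc (diagram R k) c).hom⟩

end

variable (R k : Type u) [CommRing R] [IsDomain R] [IsLocalRing R] [IsIntegrallyClosed R] [Field k]
  [Algebra R k] [Algebra (IsLocalRing.ResidueField R) k]
  [IsScalarTower R (IsLocalRing.ResidueField R) k]
  [Algebra.IsAlgebraic (IsLocalRing.ResidueField R) k]

variable {R k} in
theorem map_mem_map_localization_of_mem_plusContraction (Q : Ideal (AbsoluteIntegralClosure R))
    [Q.IsMaximal] {I : Ideal R} {r : R}
    (hr : r ∈ plusContraction (Limits.colimit (diagram R k) : CommAlgCat.{u} R) I) :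
    algebraMap R (Localization.AtPrime Q) r ∈ I.map (algebraMap R (Localization.AtPrime Q)) := by
  let F := AlgebraicClosure (FractionRing R)
  let B := AbsoluteIntegralClosure R
  let C := Localization.AtPrime Q
  have : IsFractionRing B F := isFractionRing_absoluteIntegralClosure R
  have : IsIntegrallyClosed B := .of_isIntegrallyClosedIn B F
  have hQ : Q.primeCompl ≤ nonZeroDivisors B := Q.primeCompl_le_nonZeroDivisors
  have : IsDomain C := IsLocalization.isDomain_localization hQ
  have : IsIntegrallyClosed C := isIntegrallyClosed_of_isLocalization C Q.primeCompl hQ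
  obtain ⟨_, _⟩ : ∃ _ : Algebra C F, IsFractionRing C F :=
    Localization.AtPrime.exists_algebra_isFractionRing Q
  have : IsIntegrallyClosedIn C F := (isIntegrallyClosed_iff_isIntegrallyClosedIn F).mp ‹_›
  have hRB : Function.Injective (algebraMap R B) :=
    algebraMap_absoluteIntegralClosure_injective R
  have hRC : Function.Injective (algebraMap R C) := by
    rw [IsScalarTower.algebraMap_eq R B C]
    exact (IsLocalization.injective C hQ).comp hRB
  -- By integrality, `Q` lies over the maximal ideal of `R`.
  have : IsLocalHom (algebraMap R C) := by
    refine ⟨fun x hx ↦ ?_⟩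
    by_contra hxu
    have hmax : (Q.comap (algebraMap R B)).IsMaximal :=
      Ideal.isMaximal_comap_of_isIntegral_of_isMaximal Q
    have hxQ : algebraMap R B x ∈ Q := by
      rw [← Ideal.mem_comap, IsLocalRing.eq_maximalIdeal hmax]
      exact hxu
    rw [IsScalarTower.algebraMap_apply R B C] at hx
    exact (IsLocalization.AtPrime.isUnit_to_map_iff C Q _).mp hx hxQ
  obtain ⟨f⟩ := nonempty_colimit_algHom (R := R) (k := k) (A := C) F
  have hf : Function.Injective f := by
    rw [injective_iff_map_eq_zero]
    intro a ha
    obtain ⟨X, _, hX⟩ := exists_isDomain_forall_mem_range {a}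
    obtain ⟨x, rfl⟩ := hX a (Finset.mem_singleton_self a)
    rw [Algebra.Etale.injective_of_isDomain hRC (f.comp X.toColimit)
      (ha.trans (map_zero (f.comp X.toColimit)).symm), map_zero]
  have := map_mem_map_of_mem_plusContraction (F := F) f.toRingHom hf hr
  rw [show f.toRingHom.comp (algebraMap R _) = algebraMap R C from f.comp_algebraMap] at this
  rwa [← f.commutes]

theorem plusContraction_colimit (I : Ideal R) :
    plusContraction (Limits.colimit (diagram R k) : CommAlgCat.{u} R) I = plusContraction R I := by
  refine le_antisymm (fun r hr ↦ ?_) fun r hr ↦ ?_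
  · refine Ideal.mem_comap.mpr (Ideal.mem_of_localization_maximal fun Q hQ ↦ ?_)
    rw [Ideal.map_map]
    exact map_mem_map_localization_of_mem_plusContraction Q hr
  · let A := (Limits.colimit (diagram R k) : CommAlgCat.{u} R)
    have hinj : Function.Injective ((algebraMap A (AbsoluteIntegralClosure A)).comp
        (algebraMap R A)) :=
      (algebraMap_absoluteIntegralClosure_injective A).comp
        (algebraMap_colimit_injective R k)
    -- The same extension lemma, now with `B = R` and `C = A⁺`.
    exact Ideal.mem_comap.mpr (map_mem_map_of_mem_plusContraction
      (F := AlgebraicClosure (FractionRing A)) _ hinj hr)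

end PointedEtale

theorem mainTheorem4 (R : Type u) [CommRing R] [IsDomain R] [IsLocalRing R] [IsIntegrallyClosed R]
    (ksep : Type u) [Field ksep] [Algebra (IsLocalRing.ResidueField R) ksep]
    [IsSepClosure (IsLocalRing.ResidueField R) ksep]
    [Algebra R ksep] [IsScalarTower R (IsLocalRing.ResidueField R) ksep] :
    ∃ (_ : IsDomain (Henselization R)) (_ : IsDomain (StrictHenselization R ksep)),
      IsIntegrallyClosed (Henselization R) ∧
      IsIntegrallyClosed (StrictHenselization R ksep) ∧
      ∀ I : Ideal R,
        plusContraction (Henselization R) I = plusContraction R I ∧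
        plusContraction R I = plusContraction (StrictHenselization R ksep) I := by
  have : Algebra.IsSeparable (IsLocalRing.ResidueField R) ksep := IsSepClosure.separable
  refine ⟨inferInstance, inferInstance,
    (PointedEtale.isDomain_and_isIntegrallyClosed_colimit R _).2,
    (PointedEtale.isDomain_and_isIntegrallyClosed_colimit R ksep).2, fun I ↦ ⟨?_, ?_⟩⟩
  · exact PointedEtale.plusContraction_colimit R _ I
  · exact (PointedEtale.plusContraction_colimit R ksep I).symm
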